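/- **Setting.** Let $d\ge 1$ and let $\Omega\subset\mathbb R^d$ be open, bounded and connected, with Lipschitz boundary. Let $\Gamma_1,\Gamma_2,\Gamma_3$ be measurable, pairwise disjoint subsets of $\partial\Omega$ with $\Gamma_1\cup\Gamma_2\cup\Gamma_3=\partial\Omega$, where $\Gamma_1$ has positive $(d-1)$-dimensional measure. Let $\Lambda$ be a measurable function from $\Omega$ to the real $d\times d$ matrices, and let $\underline\lambda,\overline\lambda>0$ be such that for a.e. $x\in\Omega$ the matrix $\Lambda(x)$ is symmetric with eigenvalues in $[\underline\lambda,\overline\lambda]$. Let $f\in L^2(\Omega)$ and $a\in L^2(\partial\Omega)$. Let $H^{1/2}(\partial\Omega)=\gamma(H^1(\Omega))\subset L^2(\partial\Omega)$, where $\gamma$ is the trace operator, with norm $\|g\|_{H^{1/2}(\partial\Omega)}=\inf\{\|w\|_{H^1(\Omega)}:\gamma w=g\}$, and let $H^{1/2}_{\Gamma_1}(\partial\Omega)=\{g\in H^{1/2}(\partial\Omega): g=0\text{ on }\Gamma_1\}$. Let $H_{\rm div}(\Omega)$ be the set of $\psi\in L^2(\Omega)^d$ with weak divergence $\mathrm{div}\,\psi\in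 L^2(\Omega)$. For $\psi\in H_{\rm div}(\Omega)$ and $g=\gamma w\in H^{1/2}(\partial\Omega)$, $w\in H^1(\Omega)$, set $$\langle\gamma_{\mathbf n}(\psi),g\rangle=\int_\Omega\psi\cdot\nabla w\,dx+\int_\Omega \mathrm{div}(\psi)\,w\,dx ,$$ which does not depend on the choice of $w$. Let $\mathcal K=\{v\in H^1(\Omega):\gamma v=0\text{ on }\Gamma_1,\ \gamma v\le a\text{ on }\Gamma_3\}$, assumed non-empty, and let $\bar u\in\mathcal K$ be the solution of the weak Signorini problem $$\int_\Omega\Lambda\nabla\bar u\cdot\nabla(\bar u-v)\,dx\le\int_\Omega f(\bar u-v)\,dx\qquad\text{for all }v\in\mathcal K .$$ **Discretisation.** Let $\mathcal D=(X_{\mathcal D,\Gamma_1},\Pi_{\mathcal D},\mathbb T_{\mathcal D},\nabla_{\mathcal D})$, where $X_{\mathcal D,\Gamma_1}$ is a finite-dimensional real vector space and $\Pi_{\mathcal D}:X_{\mathcal D,\Gamma_1}\to L^2(\Omega)$, $\mathbb T_{\mathcal D}:X_{\mathcal D,\Gamma_1}\to H^{1/2}_{\Gamma_1}(\partial\Omega)$,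 $\nabla_{\mathcal D}:X_{\mathcal D,\Gamma_1}\to L^2(\Omega)^d$ are linear maps such that $v\mapsto\|\nabla_{\mathcal D}v\|_{L^2(\Omega)^d}$ is a norm on $X_{\mathcal D,\Gamma_1}$. Define $$C_{\mathcal D}=\max_{v\in X_{\mathcal D,\Gamma_1}\setminus\{0\}}\left(\frac{\|\Pi_{\mathcal D}v\|_{L^2(\Omega)}}{\|\nabla_{\mathcal D}v\|_{L^2(\Omega)^d}}+\frac{\|\mathbb T_{\mathcal D}v\|_{H^{1/2}(\partial\Omega)}}{\|\nabla_{\mathcal D}v\|_{L^2(\Omega)^d}}\right),$$ $$S_{\mathcal D}(\varphi,v)=\|\Pi_{\mathcal D}v-\varphi\|_{L^2(\Omega)}+\|\nabla_{\mathcal D}v-\nabla\varphi\|_{L^2(\Omega)^d}\qquad(\varphi\in H^1(\Omega),\ v\in X_{\mathcal D,\Gamma_1}),$$ $$W_{\mathcal D}(\psi)=\sup_{v\in X_{\mathcal D,\Gamma_1}\setminus\{0\}}\frac{1}{\|\nabla_{\mathcal D}v\|_{L^2(\Omega)^d}}\left|\int_\Omega(\nabla_{\mathcal D}v\cdot\psi+\Pi_{\mathcal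 D}v\,\mathrm{div}\,\psi)\,dx-\langle\gamma_{\mathbf n}(\psi),\mathbb T_{\mathcal D}v\rangle\right|\qquad(\psi\in H_{\rm div}(\Omega)),$$ where the maximum and the supremum are $0$ if $X_{\mathcal D,\Gamma_1}=\{0\}$. **Theorem.** Let $a_{\mathcal D}\in L^2(\partial\Omega)$, and assume that $\widetilde{\mathcal K}_{\mathcal D}=\{v\in X_{\mathcal D,\Gamma_1}:\mathbb T_{\mathcal D}v\le a_{\mathcal D}\text{ on }\Gamma_3\}$ is non-empty. Then there is exactly one $u\in\widetilde{\mathcal K}_{\mathcal D}$ such that $$\int_\Omega\Lambda\nabla_{\mathcal D}u\cdot\nabla_{\mathcal D}(u-v)\,dx\le\int_\Omega f\,\Pi_{\mathcal D}(u-v)\,dx\qquad\text{for all }v\in\widetilde{\mathcal K}_{\mathcal D}.$$ Moreover $\Lambda\nabla\bar u\in H_{\rm div}(\Omega)$ and, if $a-a_{\mathcal D}\in H^{1/2}_{\Gamma_1}(\partial\Omega)$, then for every $v_{\mathcal D}\in\widetilde{\mathcal K}_{\mathcal D}$, with $$\widetilde G=\langle\gamma_{\mathbf n}(\Lambda\nabla\bar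 u),\mathbb T_{\mathcal D}v_{\mathcal D}-\gamma\bar u\rangle+\langle\gamma_{\mathbf n}(\Lambda\nabla\bar u),a-a_{\mathcal D}\rangle,\qquad \widetilde G^+=\max(0,\widetilde G),$$ one has $$\|\nabla_{\mathcal D}u-\nabla\bar u\|_{L^2(\Omega)^d}\le\sqrt{\tfrac{2}{\underline\lambda}\widetilde G^+}+\frac1{\underline\lambda}\left[W_{\mathcal D}(\Lambda\nabla\bar u)+(\overline\lambda+\underline\lambda)S_{\mathcal D}(\bar u,v_{\mathcal D})\right],$$ $$\|\Pi_{\mathcal D}u-\bar u\|_{L^2(\Omega)}\le C_{\mathcal D}\sqrt{\tfrac{2}{\underline\lambda}\widetilde G^+}+\frac1{\underline\lambda}\left[C_{\mathcal D}W_{\mathcal D}(\Lambda\nabla\bar u)+(C_{\mathcal D}\overline\lambda+\underline\lambda)S_{\mathcal D}(\bar u,v_{\mathcal D})\right].$$ -/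

import Mathlib

open MeasureTheory Filter
open scoped ENNReal Topology ContDiff MeasureTheory

noncomputable section

/-- The Euclidean space `ℝ^d`. -/
abbrev Eucl (d : ℕ) : Type := EuclideanSpace ℝ (Fin d)

/-- `L²(Ω)`. -/
abbrev L2Dom {d : ℕ} (Ω : Set (Eucl d)) : Type := Lp ℝ 2 (volume.restrict Ω)

/-- `L²(Ω)^d`. -/
abbrev L2Vec {d : ℕ} (Ω : Set (Eucl d)) : Type := Lp (Eucl d) 2 (volume.restrict Ω)

/-- The `(d-1)`-dimensional measure on `∂Ω`. -/
def surfaceMeasure {d : ℕ} (Ω : Set (Eucl d)) : Measure (Eucl d) :=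
  (μHE[d - 1]).restrict (frontier Ω)

/-- `L²(∂Ω)`. -/
abbrev L2Bdry {d : ℕ} (Ω : Set (Eucl d)) : Type := Lp ℝ 2 (surfaceMeasure Ω)

/-- `Ω` has a Lipschitz boundary: near each boundary point, and after a choice of a direction `e`,
`Ω` is the set of points lying strictly above the graph of a Lipschitz function of the component
orthogonal to `e`. -/
def HasLipschitzBoundary {d : ℕ} (Ω : Set (Eucl d)) : Prop :=
  ∀ x ∈ frontier Ω, ∃ U : Set (Eucl d), IsOpen U ∧ x ∈ U ∧
    ∃ e : Eucl d, ‖e‖ = 1 ∧ ∃ (K : NNReal) (h : Eucl d → ℝ), LipschitzWith K h ∧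
      ∀ y ∈ U, (y ∈ Ω ↔ h (y - inner ℝ e y • e) < inner ℝ e y)

/-- Test functions on the open set `Ω`: smooth, with compact support contained in `Ω`. -/
def IsTestFunction {d : ℕ} (Ω : Set (Eucl d)) (φ : Eucl d → ℝ) : Prop :=
  ContDiff ℝ ∞ φ ∧ HasCompactSupport φ ∧ tsupport φ ⊆ Ω

/-- `G` is the weak gradient of `u` on `Ω`. -/
def HasWeakGradient {d : ℕ} {Ω : Set (Eucl d)} (u : L2Dom Ω) (G : L2Vec Ω) : Prop :=
  ∀ φ : Eucl d → ℝ, IsTestFunction Ω φ →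
    ∫ x in Ω, u x • gradient φ x = - ∫ x in Ω, φ x • G x

/-- `q` is the weak divergence of the vector field `ψ` on `Ω`. -/
def HasWeakDivergence {d : ℕ} {Ω : Set (Eucl d)} (ψ : Eucl d → Eucl d) (q : L2Dom Ω) : Prop :=
  ∀ φ : Eucl d → ℝ, IsTestFunction Ω φ →
    ∫ x in Ω, inner ℝ (ψ x) (gradient φ x) = - ∫ x in Ω, q x * φ x

theorem IsTestFunction.memLp {d : ℕ} {Ω : Set (Eucl d)} {φ : Eucl d → ℝ}
    (hφ : IsTestFunction Ω φ) : MemLp φ 2 (volume.restrict Ω) :=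
  (hφ.1.continuous.memLp_of_hasCompactSupport hφ.2.1 (μ := volume)).restrict Ω

theorem ContDiff.continuous_gradient_eucl {d : ℕ} {φ : Eucl d → ℝ} (hφ : ContDiff ℝ ∞ φ) :
    Continuous (gradient φ) := by
  have h : Continuous (fderiv ℝ φ) := hφ.continuous_fderiv (by simp)
  exact (InnerProductSpace.toDual ℝ (Eucl d)).symm.continuous.comp h

theorem IsTestFunction.memLp_gradient {d : ℕ} {Ω : Set (Eucl d)} {φ : Eucl d → ℝ}
    (hφ : IsTestFunction Ω φ) : MemLp (gradient φ) 2 (volume.restrict Ω) := by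
  have h : HasCompactSupport (gradient φ) :=
    (hφ.2.1.fderiv (𝕜 := ℝ)).comp_left
      (g := (InnerProductSpace.toDual ℝ (Eucl d)).symm) (by simp)
  exact (hφ.1.continuous_gradient_eucl.memLp_of_hasCompactSupport h (μ := volume)).restrict Ω

/-- The Sobolev space `H¹(Ω)`. An element is a function `u ∈ L²(Ω)` together with its weak gradient
(which is determined by `u`), and the norm is `(‖u‖² + ‖∇u‖²)^{1/2}`. -/
def H1 {d : ℕ} (Ω : Set (Eucl d)) : Submodule ℝ (WithLp 2 (L2Dom Ω × L2Vec Ω)) where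
  carrier := {w | HasWeakGradient w.fst w.snd}
  zero_mem' := by
    intro φ _
    have h1 : ∀ᵐ x ∂volume.restrict Ω, (0 : L2Dom Ω) x • gradient φ x = 0 := by
      filter_upwards [Lp.coeFn_zero ℝ 2 (volume.restrict Ω)] with x hx
      rw [hx, Pi.zero_apply, zero_smul]
    have h2 : ∀ᵐ x ∂volume.restrict Ω, φ x • (0 : L2Vec Ω) x = 0 := by
      filter_upwards [Lp.coeFn_zero (Eucl d) 2 (volume.restrict Ω)] with x hx
      rw [hx, Pi.zero_apply, smul_zero]
    change ∫ x in Ω, (0 : L2Dom Ω) x • gradient φ x = - ∫ x in Ω, φ x • (0 : L2Vec Ω) x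
    rw [integral_congr_ae h1, integral_congr_ae h2]
    simp
  add_mem' := by
    intro v w hv hw φ hφ
    have i1 : ∀ z : L2Dom Ω, Integrable (fun x => z x • gradient φ x) (volume.restrict Ω) :=
      fun z => memLp_one_iff_integrable.1
        (MemLp.smul (p := 2) (q := 2) (r := 1) hφ.memLp_gradient (Lp.memLp z))
    have i2 : ∀ z : L2Vec Ω, Integrable (fun x => φ x • z x) (volume.restrict Ω) :=
      fun z => memLp_one_iff_integrable.1
        (MemLp.smul (p := 2) (q := 2) (r := 1) (Lp.memLp z) hφ.memLp)
    have h1 : ∀ᵐ x ∂volume.restrict Ω, (v.fst + w.fst : L2Dom Ω) x • gradient φ x =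
        v.fst x • gradient φ x + w.fst x • gradient φ x := by
      filter_upwards [Lp.coeFn_add v.fst w.fst] with x hx
      rw [hx, Pi.add_apply, add_smul]
    have h2 : ∀ᵐ x ∂volume.restrict Ω, φ x • (v.snd + w.snd : L2Vec Ω) x =
        φ x • v.snd x + φ x • w.snd x := by
      filter_upwards [Lp.coeFn_add v.snd w.snd] with x hx
      rw [hx, Pi.add_apply, smul_add]
    change ∫ x in Ω, (v.fst + w.fst : L2Dom Ω) x • gradient φ x =
      - ∫ x in Ω, φ x • (v.snd + w.snd : L2Vec Ω) x
    rw [integral_congr_ae h1, integral_congr_ae h2, integral_add (i1 _) (i1 _),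
      integral_add (i2 _) (i2 _), hv φ hφ, hw φ hφ, neg_add]
  smul_mem' := by
    intro c w hw φ hφ
    have h1 : ∀ᵐ x ∂volume.restrict Ω, (c • w.fst : L2Dom Ω) x • gradient φ x =
        c • (w.fst x • gradient φ x) := by
      filter_upwards [Lp.coeFn_smul c w.fst] with x hx
      rw [hx, Pi.smul_apply, smul_assoc]
    have h2 : ∀ᵐ x ∂volume.restrict Ω, φ x • (c • w.snd : L2Vec Ω) x =
        c • (φ x • w.snd x) := by
      filter_upwards [Lp.coeFn_smul c w.snd] with x hx
      rw [hx, Pi.smul_apply, smul_comm]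
    change ∫ x in Ω, (c • w.fst : L2Dom Ω) x • gradient φ x =
      - ∫ x in Ω, φ x • (c • w.snd : L2Vec Ω) x
    rw [integral_congr_ae h1, integral_congr_ae h2, integral_smul, integral_smul, hw φ hφ, smul_neg]

/-- The underlying function of an element of `H¹(Ω)`. -/
def sobVal {d : ℕ} {Ω : Set (Eucl d)} (w : H1 Ω) : L2Dom Ω := w.1.fst

/-- The gradient of an element of `H¹(Ω)`. -/
def sobGrad {d : ℕ} {Ω : Set (Eucl d)} (w : H1 Ω) : L2Vec Ω := w.1.snd

theorem sobVal_add {d : ℕ} {Ω : Set (Eucl d)} (v w : H1 Ω) :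
    sobVal (v + w) = sobVal v + sobVal w := rfl

theorem sobGrad_add {d : ℕ} {Ω : Set (Eucl d)} (v w : H1 Ω) :
    sobGrad (v + w) = sobGrad v + sobGrad w := rfl

theorem sobVal_smul {d : ℕ} {Ω : Set (Eucl d)} (c : ℝ) (w : H1 Ω) :
    sobVal (c • w) = c • sobVal w := rfl

theorem sobGrad_smul {d : ℕ} {Ω : Set (Eucl d)} (c : ℝ) (w : H1 Ω) :
    sobGrad (c • w) = c • sobGrad w := rfl

theorem sobVal_zero {d : ℕ} {Ω : Set (Eucl d)} : sobVal (0 : H1 Ω) = 0 := rfl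

theorem sobGrad_zero {d : ℕ} {Ω : Set (Eucl d)} : sobGrad (0 : H1 Ω) = 0 := rfl

/-- `γ w = g`: the trace on `∂Ω` of `w ∈ H¹(Ω)` is `g ∈ L²(∂Ω)`. This is the graph of the trace
operator, the continuous extension to `H¹(Ω)` of the restriction map `φ ↦ φ|_{∂Ω}` on the functions
that are smooth up to the boundary. -/
def IsTrace {d : ℕ} {Ω : Set (Eucl d)} (w : H1 Ω) (g : L2Bdry Ω) : Prop :=
  ∃ φ : ℕ → Eucl d → ℝ, (∀ n, ContDiff ℝ ∞ (φ n)) ∧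
    Tendsto (fun n => eLpNorm (fun x => φ n x - sobVal w x) 2 (volume.restrict Ω)) atTop (𝓝 0) ∧
    Tendsto (fun n => eLpNorm (fun x => gradient (φ n) x - sobGrad w x) 2 (volume.restrict Ω))
      atTop (𝓝 0) ∧
    Tendsto (fun n => eLpNorm (fun x => φ n x - g x) 2 (surfaceMeasure Ω)) atTop (𝓝 0)

theorem tendsto_eLpNorm_sub_add {α F : Type*} [MeasurableSpace α] [NormedAddCommGroup F]
    {μ : Measure α} {a b : ℕ → α → F} (u v : Lp F 2 μ)
    (ha : ∀ n, AEStronglyMeasurable (a n) μ) (hb : ∀ n, AEStronglyMeasurable (b n) μ)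
    (h1 : Tendsto (fun n => eLpNorm (fun x => a n x - u x) 2 μ) atTop (𝓝 0))
    (h2 : Tendsto (fun n => eLpNorm (fun x => b n x - v x) 2 μ) atTop (𝓝 0)) :
    Tendsto (fun n => eLpNorm (fun x => (a n x + b n x) - (u + v : Lp F 2 μ) x) 2 μ)
      atTop (𝓝 0) := by
  have h := h1.add h2
  rw [add_zero] at h
  refine tendsto_of_tendsto_of_tendsto_of_le_of_le tendsto_const_nhds h (fun _ => zero_le) ?_
  intro n
  have e : eLpNorm (fun x => (a n x + b n x) - (u + v : Lp F 2 μ) x) 2 μ =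
      eLpNorm ((fun x => a n x - u x) + fun x => b n x - v x) 2 μ := by
    refine eLpNorm_congr_ae ?_
    filter_upwards [Lp.coeFn_add u v] with x hx
    rw [hx]
    simp only [Pi.add_apply]
    abel
  change eLpNorm (fun x => (a n x + b n x) - (u + v : Lp F 2 μ) x) 2 μ ≤ _
  rw [e]
  exact eLpNorm_add_le ((ha n).sub (Lp.aestronglyMeasurable u))
    ((hb n).sub (Lp.aestronglyMeasurable v)) (by norm_num)

theorem tendsto_eLpNorm_sub_smul {α F : Type*} [MeasurableSpace α] [NormedAddCommGroup F]
    [NormedSpace ℝ F] {μ : Measure α} {a : ℕ → α → F} (c : ℝ) (u : Lp F 2 μ)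
    (h1 : Tendsto (fun n => eLpNorm (fun x => a n x - u x) 2 μ) atTop (𝓝 0)) :
    Tendsto (fun n => eLpNorm (fun x => c • a n x - (c • u : Lp F 2 μ) x) 2 μ)
      atTop (𝓝 0) := by
  have h := ENNReal.Tendsto.const_mul (a := ‖c‖ₑ) h1 (Or.inr (by simp))
  rw [mul_zero] at h
  refine h.congr fun n => ?_
  rw [← eLpNorm_const_smul]
  refine eLpNorm_congr_ae ?_
  filter_upwards [Lp.coeFn_smul c u] with x hx
  rw [hx]
  simp only [Pi.smul_apply, smul_sub]

theorem gradient_add_eucl {d : ℕ} {φ ψ : Eucl d → ℝ} (hφ : ContDiff ℝ ∞ φ) (hψ : ContDiff ℝ ∞ ψ)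
    (x : Eucl d) : gradient (fun y => φ y + ψ y) x = gradient φ x + gradient ψ x := by
  unfold gradient
  rw [fderiv_fun_add (hφ.differentiable (by simp) x) (hψ.differentiable (by simp) x), map_add]

theorem gradient_smul_eucl {d : ℕ} {φ : Eucl d → ℝ} (hφ : ContDiff ℝ ∞ φ)
    (c : ℝ) (x : Eucl d) : gradient (fun y => c • φ y) x = c • gradient φ x := by
  unfold gradient
  rw [fderiv_fun_const_smul (hφ.differentiable (by simp) x), map_smul]

theorem IsTrace.add {d : ℕ} {Ω : Set (Eucl d)} {v w : H1 Ω} {g h : L2Bdry Ω}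
    (hv : IsTrace v g) (hw : IsTrace w h) : IsTrace (v + w) (g + h) := by
  obtain ⟨φ, hφ, a1, a2, a3⟩ := hv
  obtain ⟨ψ, hψ, b1, b2, b3⟩ := hw
  refine ⟨fun n x => φ n x + ψ n x, fun n => (hφ n).add (hψ n), ?_, ?_, ?_⟩
  · rw [sobVal_add]
    exact tendsto_eLpNorm_sub_add _ _ (fun n => (hφ n).continuous.aestronglyMeasurable)
      (fun n => (hψ n).continuous.aestronglyMeasurable) a1 b1
  · rw [sobGrad_add]
    simp only [gradient_add_eucl (hφ _) (hψ _)]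
    exact tendsto_eLpNorm_sub_add _ _
      (fun n => (hφ n).continuous_gradient_eucl.aestronglyMeasurable)
      (fun n => (hψ n).continuous_gradient_eucl.aestronglyMeasurable) a2 b2
  · exact tendsto_eLpNorm_sub_add _ _ (fun n => (hφ n).continuous.aestronglyMeasurable)
      (fun n => (hψ n).continuous.aestronglyMeasurable) a3 b3

theorem IsTrace.smul {d : ℕ} {Ω : Set (Eucl d)} {w : H1 Ω} {g : L2Bdry Ω} (c : ℝ)
    (hw : IsTrace w g) : IsTrace (c • w) (c • g) := by
  obtain ⟨φ, hφ, a1, a2, a3⟩ := hw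
  refine ⟨fun n x => c • φ n x, fun n => (hφ n).const_smul c, ?_, ?_, ?_⟩
  · rw [sobVal_smul]
    exact tendsto_eLpNorm_sub_smul c _ a1
  · rw [sobGrad_smul]
    simp only [gradient_smul_eucl (hφ _)]
    exact tendsto_eLpNorm_sub_smul c _ a2
  · exact tendsto_eLpNorm_sub_smul c _ a3

theorem isTrace_zero {d : ℕ} {Ω : Set (Eucl d)} : IsTrace (0 : H1 Ω) (0 : L2Bdry Ω) := by
  have e1 : ∀ {F : Type} [NormedAddCommGroup F] (μ : Measure (Eucl d)),
      eLpNorm (fun x => (0 : F) - (0 : Lp F 2 μ) x) 2 μ = 0 := by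
    intro F _ μ
    rw [eLpNorm_congr_ae (g := 0), eLpNorm_zero]
    filter_upwards [Lp.coeFn_zero F 2 μ] with x hx
    rw [hx]
    simp
  have e2 : ∀ x : Eucl d, gradient (fun _ : Eucl d => (0 : ℝ)) x = 0 := by
    intro x
    simp [gradient]
  refine ⟨fun _ _ => 0, fun _ => contDiff_const, ?_, ?_, ?_⟩
  · rw [sobVal_zero]
    exact tendsto_const_nhds.congr fun _ => (e1 _).symm
  · rw [sobGrad_zero]
    simp only [e2]
    exact tendsto_const_nhds.congr fun _ => (e1 _).symm
  · exact tendsto_const_nhds.congr fun _ => (e1 _).symm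

/-- `H^{1/2}(∂Ω)`, the range of the trace operator. -/
def HHalf {d : ℕ} (Ω : Set (Eucl d)) : Submodule ℝ (L2Bdry Ω) where
  carrier := {g | ∃ w : H1 Ω, IsTrace w g}
  zero_mem' := ⟨0, isTrace_zero⟩
  add_mem' := by
    rintro g h ⟨v, hv⟩ ⟨w, hw⟩
    exact ⟨v + w, hv.add hw⟩
  smul_mem' := by
    rintro c g ⟨w, hw⟩
    exact ⟨c • w, hw.smul c⟩

/-- The norm of `H^{1/2}(∂Ω)`, `‖g‖ = inf {‖w‖_{H¹(Ω)} : w ∈ H¹(Ω), γ w = g}`. -/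
def hHalfNorm {d : ℕ} {Ω : Set (Eucl d)} (g : HHalf Ω) : ℝ :=
  ⨅ w : {w : H1 Ω // IsTrace w (g : L2Bdry Ω)}, ‖w.1‖

/-- `g = 0` on the part `Γ` of the boundary. -/
def VanishesOn {d : ℕ} {Ω : Set (Eucl d)} (g : L2Bdry Ω) (Γ : Set (Eucl d)) : Prop :=
  ∀ᵐ x ∂(surfaceMeasure Ω).restrict Γ, g x = 0

/-- `g ≤ h` on the part `Γ` of the boundary. -/
def LeOn {d : ℕ} {Ω : Set (Eucl d)} (g h : L2Bdry Ω) (Γ : Set (Eucl d)) : Prop :=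
  ∀ᵐ x ∂(surfaceMeasure Ω).restrict Γ, g x ≤ h x

/-- `H^{1/2}_Γ(∂Ω) = {g ∈ H^{1/2}(∂Ω) : g = 0 on Γ}`. -/
def HHalfZero {d : ℕ} (Ω Γ : Set (Eucl d)) : Submodule ℝ (HHalf Ω) where
  carrier := {g | VanishesOn (g : L2Bdry Ω) Γ}
  zero_mem' := by
    have h := ae_restrict_of_ae (s := Γ) (Lp.coeFn_zero ℝ 2 (surfaceMeasure Ω))
    filter_upwards [h] with x hx
    simpa using hx
  add_mem' := by
    intro g h hg hh
    change ∀ᵐ x ∂(surfaceMeasure Ω).restrict Γ, ((g + h : HHalf Ω) : L2Bdry Ω) x = 0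
    have e := ae_restrict_of_ae (s := Γ) (Lp.coeFn_add (g : L2Bdry Ω) (h : L2Bdry Ω))
    filter_upwards [e, hg, hh] with x hx h1 h2
    simp only [Submodule.coe_add]
    rw [hx, Pi.add_apply, h1, h2, add_zero]
  smul_mem' := by
    intro c g hg
    change ∀ᵐ x ∂(surfaceMeasure Ω).restrict Γ, ((c • g : HHalf Ω) : L2Bdry Ω) x = 0
    have e := ae_restrict_of_ae (s := Γ) (Lp.coeFn_smul c (g : L2Bdry Ω))
    filter_upwards [e, hg] with x hx h1
    simp only [Submodule.coe_smul]
    rw [hx, Pi.smul_apply, h1, smul_zero]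

/-- `ψ ∈ H_div(Ω)`: `ψ ∈ L²(Ω)^d` has a weak divergence in `L²(Ω)`. -/
def MemHDiv {d : ℕ} (Ω : Set (Eucl d)) (ψ : Eucl d → Eucl d) : Prop :=
  MemLp ψ 2 (volume.restrict Ω) ∧ ∃ q : L2Dom Ω, HasWeakDivergence ψ q

open Classical in
/-- The weak divergence of `ψ ∈ H_div(Ω)` (unique as an element of `L²(Ω)`). -/
def weakDiv {d : ℕ} (Ω : Set (Eucl d)) (ψ : Eucl d → Eucl d) : L2Dom Ω :=
  if h : ∃ q : L2Dom Ω, HasWeakDivergence ψ q then h.choose else 0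

/-- `⟨γ_n(ψ), g⟩`, for `ψ ∈ H_div(Ω)` and `g ∈ H^{1/2}(∂Ω)`, is defined as
`∫_Ω ψ · ∇w + ∫_Ω div ψ w` where `w ∈ H¹(Ω)` has trace `g`
(by Stokes' formula the value is the same for all such `w`). -/
def normalTrace {d : ℕ} {Ω : Set (Eucl d)} (ψ : Eucl d → Eucl d) (g : HHalf Ω) : ℝ :=
  (∫ x in Ω, inner ℝ (ψ x) (sobGrad g.2.choose x)) +
    ∫ x in Ω, weakDiv Ω ψ x * sobVal g.2.choose x

/-- The vector field `Λ G`. -/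
def applyTensor {d : ℕ} {Ω : Set (Eucl d)} (Λ : Eucl d → Matrix (Fin d) (Fin d) ℝ) (G : L2Vec Ω) :
    Eucl d → Eucl d :=
  fun x => WithLp.toLp 2 (Matrix.mulVec (Λ x) (WithLp.ofLp (G x)))

/-- `𝒦 = {v ∈ H¹(Ω) : γ v = 0 on Γ₁, γ v ≤ a on Γ₃}`. -/
def signoriniSet {d : ℕ} {Ω : Set (Eucl d)} (Γ₁ Γ₃ : Set (Eucl d)) (a : L2Bdry Ω) : Set (H1 Ω) :=
  {v | ∃ g : L2Bdry Ω, IsTrace v g ∧ VanishesOn g Γ₁ ∧ LeOn g a Γ₃}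

/-- `u` is a solution of the weak form of the Signorini problem. -/
def IsSignoriniSolution {d : ℕ} {Ω : Set (Eucl d)} (Γ₁ Γ₃ : Set (Eucl d))
    (Λ : Eucl d → Matrix (Fin d) (Fin d) ℝ) (f : L2Dom Ω) (a : L2Bdry Ω) (u : H1 Ω) : Prop :=
  u ∈ signoriniSet Γ₁ Γ₃ a ∧ ∀ v ∈ signoriniSet Γ₁ Γ₃ a,
    ∫ x in Ω, inner ℝ (applyTensor Λ (sobGrad u) x) (sobGrad (u - v) x) ≤ ∫ x in Ω, f x * sobVal (u - v) x

/-- A gradient discretisation of the Signorini problem on the space of discrete unknowns `X`: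
function reconstruction, trace reconstruction and gradient reconstruction, such that
`v ↦ ‖∇_D v‖` is a norm on `X`. -/
structure GradientDiscretisation {d : ℕ} (Ω Γ₁ : Set (Eucl d)) (X : Type*) [AddCommGroup X]
    [Module ℝ X] where
  /-- The reconstructed function `Π_D`. -/
  recFun : X →ₗ[ℝ] L2Dom Ω
  /-- The reconstructed trace `T_D`. -/
  recTrace : X →ₗ[ℝ] HHalfZero Ω Γ₁
  /-- The reconstructed gradient `∇_D`. -/
  recGrad : X →ₗ[ℝ] L2Vec Ω
  eq_zero_of_norm_recGrad : ∀ v : X, ‖recGrad v‖ = 0 → v = 0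

namespace GradientDiscretisation

variable {d : ℕ} {Ω Γ₁ : Set (Eucl d)} {X : Type*} [AddCommGroup X] [Module ℝ X]

/-- The reconstructed trace `T_D v`, as an element of `H^{1/2}(∂Ω)`. -/
def tr (D : GradientDiscretisation Ω Γ₁ X) (v : X) : HHalf Ω := (D.recTrace v : HHalf Ω)

/-- `{v ∈ X : T_D v ≤ b on Γ₃}` for a barrier `b`. -/
def barrierSet (D : GradientDiscretisation Ω Γ₁ X) (Γ₃ : Set (Eucl d)) (b : L2Bdry Ω) : Set X :=
  {v | LeOn (D.tr v : L2Bdry Ω) b Γ₃}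

/-- `u` is a solution of the gradient scheme with barrier `b`. -/
def IsSchemeSolution (D : GradientDiscretisation Ω Γ₁ X) (Γ₃ : Set (Eucl d))
    (Λ : Eucl d → Matrix (Fin d) (Fin d) ℝ) (f : L2Dom Ω) (b : L2Bdry Ω) (u : X) : Prop :=
  u ∈ D.barrierSet Γ₃ b ∧ ∀ v ∈ D.barrierSet Γ₃ b,
    ∫ x in Ω, inner ℝ (applyTensor Λ (D.recGrad u) x) (D.recGrad (u - v) x) ≤
      ∫ x in Ω, f x * D.recFun (u - v) x

/-- The coercivity constant `C_D`. -/
def coercivity (D : GradientDiscretisation Ω Γ₁ X) : ℝ :=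
  ⨆ v : {v : X // v ≠ 0},
    (‖D.recFun v‖ / ‖D.recGrad v‖ + hHalfNorm (D.tr v) / ‖D.recGrad v‖)

/-- The consistency indicator `S_D(φ, v)`. -/
def consistency (D : GradientDiscretisation Ω Γ₁ X) (φ : H1 Ω) (v : X) : ℝ :=
  ‖D.recFun v - sobVal φ‖ + ‖D.recGrad v - sobGrad φ‖

/-- The limit-conformity indicator `W_D(ψ)`, for `ψ ∈ H_div(Ω)`. -/
def limitConformity (D : GradientDiscretisation Ω Γ₁ X) (ψ : Eucl d → Eucl d) : ℝ :=
  ⨆ v : {v : X // v ≠ 0}, 1 / ‖D.recGrad v‖ *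
    |(∫ x in Ω, (inner ℝ (D.recGrad v x) (ψ x) + D.recFun v x * weakDiv Ω ψ x)) -
      normalTrace ψ (D.tr v)|

end GradientDiscretisation

end

/-! The discrete problem is a variational inequality for the inner product `∫ Λ∇_D v · ∇_D w` on a
finite-dimensional space, so its solution is the projection of the Riesz representative of the load
onto a closed convex set.

Perturbing `ubar` within `signoriniSet` by `±z` with `γz = 0` turns the Signorini inequality into an
equality. With test functions this gives `div(Λ∇ubar) = -f`. With general `z` it shows that `∫
Λ∇ubar · ∇w - ∫ f w` depends only on the trace of `w`, and this number is the normal trace of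
`Λ∇ubar` (`IsSignoriniSolution.normalTrace_eq`); neither Stokes' formula nor a density argument is
needed.

For the error, let `x = ‖∇_D(u - v)‖` and `S = ‖∇_D v - ∇ubar‖`. Coercivity, the scheme tested with
`v`, and the definition of `W_D` bound `λ_low x²` by `(W_D + λ_up S) x + ⟨γ_n(Λ∇ubar), T_D(v - u)⟩`.
The last term is at most `G` (`normalTrace_tr_sub_le`): since `T_D u ≤ a_D` on `Γ₃`, any lifting of
`T_D u + (a - a_D)` is admissible in the continuous problem. Solving the quadratic inequality bounds
`x`; the triangle inequality and `C_D` do the rest. -/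

noncomputable section

/-! ### Quadratic form and norm bounds from the spectrum -/

section SpectralBounds

variable {E : Type*} [NormedAddCommGroup E] [InnerProductSpace ℝ E] [FiniteDimensional ℝ E]

/-- In an orthonormal eigenbasis `⟨Tv, v⟩ = ∑ μᵢ ⟨v, bᵢ⟩²`, and Parseval gives `‖v‖² = ∑ ⟨v, bᵢ⟩²`.
-/
theorem LinearMap.IsSymmetric.le_inner_apply_self {T : E →ₗ[ℝ] E} (hT : T.IsSymmetric) {m : ℝ}
    (h : ∀ μ : ℝ, Module.End.HasEigenvalue T μ → m ≤ μ) (v : E) :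
    m * ‖v‖ ^ 2 ≤ inner ℝ (T v) v := by
  set b := hT.eigenvectorBasis rfl
  rw [← b.sum_sq_norm_inner_left v, ← b.sum_inner_mul_inner (T v) v, Finset.mul_sum]
  refine Finset.sum_le_sum fun i _ => ?_
  have e : inner ℝ (T v) (b i) = hT.eigenvalues rfl i * inner ℝ v (b i) := by
    rw [hT v (b i), hT.apply_eigenvectorBasis rfl i, inner_smul_right]
    rfl
  rw [e, real_inner_comm v (b i), Real.norm_eq_abs, sq_abs, mul_assoc, ← pow_two]
  exact mul_le_mul_of_nonneg_right (h _ (hT.hasEigenvalue_eigenvalues rfl i)) (sq_nonneg _)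

theorem LinearMap.IsSymmetric.norm_apply_le {T : E →ₗ[ℝ] E} (hT : T.IsSymmetric) {M : ℝ}
    (hM : 0 ≤ M) (h : ∀ μ : ℝ, Module.End.HasEigenvalue T μ → |μ| ≤ M) (v : E) :
    ‖T v‖ ≤ M * ‖v‖ := by
  refine le_of_sq_le_sq ?_ (by positivity)
  set b := hT.eigenvectorBasis rfl
  rw [mul_pow, ← b.sum_sq_norm_inner_left v, ← b.sum_sq_norm_inner_left (T v), Finset.mul_sum]
  refine Finset.sum_le_sum fun i _ => ?_
  have e : inner ℝ (T v) (b i) = hT.eigenvalues rfl i * inner ℝ v (b i) := by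
    rw [hT v (b i), hT.apply_eigenvectorBasis rfl i, inner_smul_right]
    rfl
  rw [e, norm_mul, mul_pow]
  gcongr
  exact h _ (hT.hasEigenvalue_eigenvalues rfl i)

end SpectralBounds

/-! ### From the matrix field to a symmetric coercive operator on `L²(Ω)^d` -/

theorem Matrix.IsSymm.isSymmetric_toEuclideanLin {n : Type*} [Fintype n] [DecidableEq n]
    {A : Matrix n n ℝ} (hA : A.IsSymm) : (Matrix.toEuclideanLin A).IsSymmetric := by
  rw [Matrix.isSymmetric_toEuclideanLin_iff, Matrix.IsHermitian,
    Matrix.conjTranspose_eq_transpose_of_trivial]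
  exact hA

/-- The ellipticity hypothesis concerns `Matrix.toLin'`, while the spectral bounds need an inner
product space. -/
theorem Matrix.hasEigenvalue_toLin'_of_toEuclideanLin {n : Type*} [Fintype n] [DecidableEq n]
    {A : Matrix n n ℝ} {μ : ℝ} (h : Module.End.HasEigenvalue (Matrix.toEuclideanLin A) μ) :
    Module.End.HasEigenvalue (Matrix.toLin' A) μ := by
  obtain ⟨v, hv⟩ := h.exists_hasEigenvector
  refine Module.End.hasEigenvalue_of_hasEigenvector (x := WithLp.ofLp v) ⟨?_, ?_⟩
  · rw [Module.End.mem_eigenspace_iff]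
    simpa using congrArg WithLp.ofLp hv.apply_eq_smul
  · simpa using hv.2

/-- A tensor field on `Ω`, measurable, and almost everywhere symmetric with eigenvalues in
`[lamLow, lamUp]`. -/
structure IsEllipticTensor {d : ℕ} (Ω : Set (Eucl d)) (Λ : Eucl d → Matrix (Fin d) (Fin d) ℝ)
    (lamLow lamUp : ℝ) : Prop where
  aemeasurable : ∀ i j, AEMeasurable (fun x => Λ x i j) (volume.restrict Ω)
  low_pos : 0 < lamLow
  up_pos : 0 < lamUp
  spectrum : ∀ᵐ x ∂volume.restrict Ω, (Λ x).IsSymm ∧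
      ∀ μ : ℝ, Module.End.HasEigenvalue (Matrix.toLin' (Λ x)) μ → μ ∈ Set.Icc lamLow lamUp

namespace IsEllipticTensor

variable {d : ℕ} {Ω : Set (Eucl d)} {Λ : Eucl d → Matrix (Fin d) (Fin d) ℝ} {lamLow lamUp : ℝ}

theorem norm_applyTensor_le (hΛ : IsEllipticTensor Ω Λ lamLow lamUp) (F : L2Vec Ω) :
    ∀ᵐ x ∂volume.restrict Ω, ‖applyTensor Λ F x‖ ≤ lamUp * ‖F x‖ := by
  filter_upwards [hΛ.spectrum] with x hx
  refine hx.1.isSymmetric_toEuclideanLin.norm_apply_le hΛ.up_pos.le (fun μ hμ => ?_) (F x)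
  have h := hx.2 μ (Matrix.hasEigenvalue_toLin'_of_toEuclideanLin hμ)
  rw [abs_of_pos (hΛ.low_pos.trans_le h.1)]
  exact h.2

theorem le_inner_applyTensor (hΛ : IsEllipticTensor Ω Λ lamLow lamUp) (F : L2Vec Ω) :
    ∀ᵐ x ∂volume.restrict Ω, lamLow * ‖F x‖ ^ 2 ≤ inner ℝ (applyTensor Λ F x) (F x) := by
  filter_upwards [hΛ.spectrum] with x hx
  exact hx.1.isSymmetric_toEuclideanLin.le_inner_apply_self
    (fun μ hμ => (hx.2 μ (Matrix.hasEigenvalue_toLin'_of_toEuclideanLin hμ)).1) (F x)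

theorem inner_applyTensor_comm (hΛ : IsEllipticTensor Ω Λ lamLow lamUp) (F G : L2Vec Ω) :
    ∀ᵐ x ∂volume.restrict Ω,
      inner ℝ (applyTensor Λ F x) (G x) = inner ℝ (F x) (applyTensor Λ G x) := by
  filter_upwards [hΛ.spectrum] with x hx
  exact hx.1.isSymmetric_toEuclideanLin (F x) (G x)

theorem aestronglyMeasurable_applyTensor (hΛ : IsEllipticTensor Ω Λ lamLow lamUp) (F : L2Vec Ω) :
    AEStronglyMeasurable (applyTensor Λ F) (volume.restrict Ω) := by
  have hF : ∀ j, AEMeasurable (fun x => F x j) (volume.restrict Ω) := fun j =>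
    (EuclideanSpace.proj (𝕜 := ℝ) j).continuous.measurable.comp_aemeasurable
      (Lp.aestronglyMeasurable F).aemeasurable
  have h : AEMeasurable (fun x => Matrix.mulVec (Λ x) (WithLp.ofLp (F x))) (volume.restrict Ω) := by
    refine aemeasurable_pi_lambda _ fun i => ?_
    simp only [Matrix.mulVec, dotProduct]
    exact Finset.aemeasurable_fun_sum _ fun j _ => (hΛ.aemeasurable i j).mul (hF j)
  exact ((PiLp.continuous_toLp 2 (fun _ : Fin d => ℝ)).measurable.comp_aemeasurable
    h).aestronglyMeasurable

theorem memLp_applyTensor (hΛ : IsEllipticTensor Ω Λ lamLow lamUp) (F : L2Vec Ω) :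
    MemLp (applyTensor Λ F) 2 (volume.restrict Ω) :=
  (Lp.memLp F).of_le_mul (hΛ.aestronglyMeasurable_applyTensor F) (hΛ.norm_applyTensor_le F)

/-- Multiplication by the tensor field, as a linear map of `L²(Ω)^d`. -/
def toLinearMap (hΛ : IsEllipticTensor Ω Λ lamLow lamUp) : L2Vec Ω →ₗ[ℝ] L2Vec Ω where
  toFun F := (hΛ.memLp_applyTensor F).toLp
  map_add' F G := by
    rw [← MemLp.toLp_add]
    refine MemLp.toLp_congr _ _ ?_
    filter_upwards [Lp.coeFn_add F G] with x hx
    simp only [applyTensor, Pi.add_apply]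
    rw [hx, Pi.add_apply, WithLp.ofLp_add, Matrix.mulVec_add, WithLp.toLp_add]
  map_smul' c F := by
    rw [RingHom.id_apply, ← MemLp.toLp_const_smul]
    refine MemLp.toLp_congr _ _ ?_
    filter_upwards [Lp.coeFn_smul c F] with x hx
    simp only [applyTensor, Pi.smul_apply]
    rw [hx, Pi.smul_apply, WithLp.ofLp_smul, Matrix.mulVec_smul, WithLp.toLp_smul]

theorem coeFn_toLinearMap (hΛ : IsEllipticTensor Ω Λ lamLow lamUp) (F : L2Vec Ω) :
    hΛ.toLinearMap F =ᵐ[volume.restrict Ω] applyTensor Λ F :=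
  (hΛ.memLp_applyTensor F).coeFn_toLp

theorem integral_inner_applyTensor (hΛ : IsEllipticTensor Ω Λ lamLow lamUp) (F G : L2Vec Ω) :
    ∫ x in Ω, inner ℝ (applyTensor Λ F x) (G x) = inner ℝ (hΛ.toLinearMap F) G := by
  rw [L2.inner_def]
  refine integral_congr_ae ?_
  filter_upwards [hΛ.coeFn_toLinearMap F] with x hx
  rw [hx]

theorem norm_toLinearMap_le (hΛ : IsEllipticTensor Ω Λ lamLow lamUp) (F : L2Vec Ω) :
    ‖hΛ.toLinearMap F‖ ≤ lamUp * ‖F‖ := by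
  refine Lp.norm_le_mul_norm_of_ae_le_mul ?_
  filter_upwards [hΛ.coeFn_toLinearMap F, hΛ.norm_applyTensor_le F] with x hx h
  rwa [hx]

theorem isSymmetric_toLinearMap (hΛ : IsEllipticTensor Ω Λ lamLow lamUp) :
    hΛ.toLinearMap.IsSymmetric := by
  intro F G
  rw [L2.inner_def, L2.inner_def]
  refine integral_congr_ae ?_
  filter_upwards [hΛ.coeFn_toLinearMap F, hΛ.coeFn_toLinearMap G,
    hΛ.inner_applyTensor_comm F G] with x h1 h2 h
  rw [h1, h2, h]

theorem le_inner_toLinearMap (hΛ : IsEllipticTensor Ω Λ lamLow lamUp) (F : L2Vec Ω) :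
    lamLow * ‖F‖ ^ 2 ≤ inner ℝ (hΛ.toLinearMap F) F := by
  rw [← real_inner_self_eq_norm_sq, L2.inner_def, L2.inner_def, ← integral_const_mul]
  refine integral_mono_ae ((L2.integrable_inner F F).const_mul _) (L2.integrable_inner _ F) ?_
  filter_upwards [hΛ.coeFn_toLinearMap F, hΛ.le_inner_applyTensor F] with x hx h
  simp only [hx, real_inner_self_eq_norm_sq]
  exact h

end IsEllipticTensor

theorem integral_mul_eq_inner_L2 {α : Type*} [MeasurableSpace α] {μ : Measure α} (f g : Lp ℝ 2 μ) :
    ∫ x, f x * g x ∂μ = inner ℝ f g := by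
  rw [L2.inner_def]
  exact integral_congr_ae (ae_of_all _ fun x => by simp [mul_comm])

theorem inner_gradient_right_eucl {d : ℕ} (φ : Eucl d → ℝ) (h x : Eucl d) :
    inner ℝ h (gradient φ x) = fderiv ℝ φ x h := by
  rw [real_inner_comm, gradient, InnerProductSpace.toDual_symm_apply]

/-! ### Test functions in `H¹(Ω)` and uniqueness of the weak divergence -/

section TestFunctions

variable {d : ℕ} {Ω : Set (Eucl d)} {φ χ : Eucl d → ℝ}

theorem IsTestFunction.eq_zero_of_notMem (hφ : IsTestFunction Ω φ) {x : Eucl d} (hx : x ∉ Ω) :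
    φ x = 0 :=
  image_eq_zero_of_notMem_tsupport fun h => hx (hφ.2.2 h)

theorem IsTestFunction.integral_smul_gradient (hφ : IsTestFunction Ω φ)
    (hχ : IsTestFunction Ω χ) :
    ∫ x in Ω, φ x • gradient χ x = - ∫ x in Ω, χ x • gradient φ x := by
  have i1 : Integrable (fun x => φ x • gradient χ x) :=
    (hφ.1.continuous.smul hχ.1.continuous_gradient_eucl).integrable_of_hasCompactSupport
      hφ.2.1.smul_right
  have i2 : Integrable (fun x => χ x • gradient φ x) :=
    (hχ.1.continuous.smul hφ.1.continuous_gradient_eucl).integrable_of_hasCompactSupport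
      hχ.2.1.smul_right
  have i3 : Integrable (fun x => φ x * χ x) :=
    (hφ.1.continuous.mul hχ.1.continuous).integrable_of_hasCompactSupport hφ.2.1.mul_right
  rw [setIntegral_eq_integral_of_forall_compl_eq_zero
      (fun x hx => by rw [hφ.eq_zero_of_notMem hx, zero_smul]),
    setIntegral_eq_integral_of_forall_compl_eq_zero
      (fun x hx => by rw [hχ.eq_zero_of_notMem hx, zero_smul])]
  -- Pairing with a constant vector `h` reduces the vector identity to scalar integration by parts
  -- in direction `h`. The integrals now run over the whole space, so no boundary term appears.
  refine ext_inner_left ℝ fun h => ?_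
  rw [inner_neg_right, ← integral_inner i1, ← integral_inner i2]
  have j1 := i1.const_inner (𝕜 := ℝ) h
  have j2 := i2.const_inner (𝕜 := ℝ) h
  simp only [inner_smul_right, inner_gradient_right_eucl] at j1 j2 ⊢
  have e := integral_mul_fderiv_eq_neg_fderiv_mul_of_integrable (μ := volume) (v := h)
    (f := φ) (g := χ) (by simpa only [mul_comm] using j2) j1 i3
    (fun x _ => hφ.1.differentiable (by simp) x) (fun x _ => hχ.1.differentiable (by simp) x)
  simpa only [mul_comm (χ _)] using e

/-- A test function, as an element of `H¹(Ω)`. -/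
def IsTestFunction.toH1 (hφ : IsTestFunction Ω φ) : H1 Ω :=
  ⟨WithLp.toLp 2 (hφ.memLp.toLp, hφ.memLp_gradient.toLp), by
    intro χ hχ
    have e1 : ∀ᵐ x ∂volume.restrict Ω, hφ.memLp.toLp φ x • gradient χ x = φ x • gradient χ x := by
      filter_upwards [hφ.memLp.coeFn_toLp] with x hx
      rw [hx]
    have e2 : ∀ᵐ x ∂volume.restrict Ω,
        χ x • hφ.memLp_gradient.toLp (gradient φ) x = χ x • gradient φ x := by
      filter_upwards [hφ.memLp_gradient.coeFn_toLp] with x hx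
      rw [hx]
    change ∫ x in Ω, hφ.memLp.toLp φ x • gradient χ x =
      - ∫ x in Ω, χ x • hφ.memLp_gradient.toLp (gradient φ) x
    rw [integral_congr_ae e1, integral_congr_ae e2]
    exact hφ.integral_smul_gradient hχ⟩

theorem IsTestFunction.sobVal_toH1 (hφ : IsTestFunction Ω φ) :
    sobVal hφ.toH1 = hφ.memLp.toLp := rfl

theorem IsTestFunction.sobGrad_toH1 (hφ : IsTestFunction Ω φ) :
    sobGrad hφ.toH1 = hφ.memLp_gradient.toLp := rfl

theorem eLpNorm_sub_eq_zero_of_ae_eq {α F : Type*} [MeasurableSpace α] [NormedAddCommGroup F]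
    {μ : Measure α} {p : ℝ≥0∞} {u v : α → F} (h : u =ᵐ[μ] v) :
    eLpNorm (fun x => u x - v x) p μ = 0 := by
  rw [eLpNorm_congr_ae (g := 0), eLpNorm_zero]
  filter_upwards [h] with x hx
  simp [hx]

/-- The constant sequence `φ` is an approximating sequence: the support of `φ` lies in the open set
`Ω`, which misses its frontier. -/
theorem IsTestFunction.isTrace_toH1 (hΩ : IsOpen Ω) (hφ : IsTestFunction Ω φ) :
    IsTrace hφ.toH1 (0 : L2Bdry Ω) := by
  refine ⟨fun _ => φ, fun _ => hφ.1, ?_, ?_, ?_⟩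
  · exact tendsto_const_nhds.congr fun _ =>
      (eLpNorm_sub_eq_zero_of_ae_eq hφ.memLp.coeFn_toLp.symm).symm
  · exact tendsto_const_nhds.congr fun _ =>
      (eLpNorm_sub_eq_zero_of_ae_eq hφ.memLp_gradient.coeFn_toLp.symm).symm
  · refine tendsto_const_nhds.congr fun _ => (eLpNorm_sub_eq_zero_of_ae_eq ?_).symm
    filter_upwards [Lp.coeFn_zero ℝ 2 (surfaceMeasure Ω),
      ae_restrict_mem isClosed_frontier.measurableSet] with x h0 hx
    rw [h0, hφ.eq_zero_of_notMem fun h => (hΩ.frontier_eq ▸ hx).2 h]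
    rfl

/-- By the fundamental lemma of the calculus of variations applied to `q - r`. It identifies the
value picked by choice in `weakDiv`. -/
theorem HasWeakDivergence.unique (hΩ : IsOpen Ω) {ψ : Eucl d → Eucl d} {q r : L2Dom Ω}
    (hq : HasWeakDivergence ψ q) (hr : HasWeakDivergence ψ r) : q = r := by
  have hi : ∀ (z : L2Dom Ω) {φ : Eucl d → ℝ}, IsTestFunction Ω φ →
      Integrable (fun x => z x * φ x) (volume.restrict Ω) :=
    fun z φ hφ => (Lp.memLp z).integrable_mul hφ.memLp
  have hloc : LocallyIntegrableOn (fun x => q x - r x) Ω volume := by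
    have hm : MemLp (fun x => q x - r x) 2 (volume.restrict Ω) := (Lp.memLp q).sub (Lp.memLp r)
    exact locallyIntegrableOn_of_locallyIntegrable_restrict (hm.locallyIntegrable one_le_two)
  have h := hΩ.ae_eq_zero_of_integral_contDiff_smul_eq_zero hloc fun φ h1 h2 h3 => by
    have hφ : IsTestFunction Ω φ := ⟨h1, h2, h3⟩
    rw [← setIntegral_eq_integral_of_forall_compl_eq_zero (s := Ω)
      (fun x hx => by rw [hφ.eq_zero_of_notMem hx, zero_smul])]
    have e : ∀ x, φ x • (q x - r x) = q x * φ x - r x * φ x := fun x => by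
      rw [smul_eq_mul]; ring
    simp only [e]
    rw [integral_sub (hi q hφ) (hi r hφ)]
    have := (hq φ hφ).symm.trans (hr φ hφ)
    linarith
  refine Lp.ext ?_
  have h' := (ae_restrict_iff' hΩ.measurableSet).2 h
  filter_upwards [h'] with x hx
  exact sub_eq_zero.1 hx

theorem weakDiv_eq (hΩ : IsOpen Ω) {ψ : Eucl d → Eucl d} {q : L2Dom Ω}
    (hq : HasWeakDivergence ψ q) : weakDiv Ω ψ = q := by
  have h : ∃ q : L2Dom Ω, HasWeakDivergence ψ q := ⟨q, hq⟩
  rw [weakDiv, dif_pos h]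
  exact h.choose_spec.unique hΩ hq

end TestFunctions

theorem sobVal_sub {d : ℕ} {Ω : Set (Eucl d)} (v w : H1 Ω) :
    sobVal (v - w) = sobVal v - sobVal w := rfl

theorem sobGrad_sub {d : ℕ} {Ω : Set (Eucl d)} (v w : H1 Ω) :
    sobGrad (v - w) = sobGrad v - sobGrad w := rfl

theorem IsTrace.sub {d : ℕ} {Ω : Set (Eucl d)} {v w : H1 Ω} {g h : L2Bdry Ω}
    (hv : IsTrace v g) (hw : IsTrace w h) : IsTrace (v - w) (g - h) := by
  simpa [sub_eq_add_neg] using hv.add (hw.smul (-1))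

/-! ### Consequences of the continuous Signorini problem -/

section Signorini

variable {d : ℕ} {Ω : Set (Eucl d)} {Λ : Eucl d → Matrix (Fin d) (Fin d) ℝ} {lamLow lamUp : ℝ}
  {Γ₁ Γ₃ : Set (Eucl d)} {f : L2Dom Ω} {a : L2Bdry Ω} {u : H1 Ω}

theorem IsSignoriniSolution.inner_le (hΛ : IsEllipticTensor Ω Λ lamLow lamUp)
    (hu : IsSignoriniSolution Γ₁ Γ₃ Λ f a u) {v : H1 Ω} (hv : v ∈ signoriniSet Γ₁ Γ₃ a) :
    inner ℝ (hΛ.toLinearMap (sobGrad u)) (sobGrad (u - v)) ≤ inner ℝ f (sobVal (u - v)) := by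
  rw [← hΛ.integral_inner_applyTensor, ← integral_mul_eq_inner_L2]
  exact hu.2 v hv

/-- Both `u + z` and `u - z` have the trace of `u`, hence are admissible; the two resulting
inequalities are opposite. -/
theorem IsSignoriniSolution.inner_eq_of_isTrace_zero (hΛ : IsEllipticTensor Ω Λ lamLow lamUp)
    (hu : IsSignoriniSolution Γ₁ Γ₃ Λ f a u) {z : H1 Ω} (hz : IsTrace z (0 : L2Bdry Ω)) :
    inner ℝ (hΛ.toLinearMap (sobGrad u)) (sobGrad z) = inner ℝ f (sobVal z) := by
  obtain ⟨g, hg, h1, h3⟩ := hu.1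
  have hm : u - z ∈ signoriniSet Γ₁ Γ₃ a := ⟨g, by simpa using hg.sub hz, h1, h3⟩
  have hp : u + z ∈ signoriniSet Γ₁ Γ₃ a := ⟨g, by simpa using hg.add hz, h1, h3⟩
  have e1 := hu.inner_le hΛ hm
  have e2 := hu.inner_le hΛ hp
  rw [sub_sub_cancel] at e1
  have e : u - (u + z) = (-1 : ℝ) • z := by simp
  rw [e, sobVal_smul, sobGrad_smul, inner_smul_right, inner_smul_right] at e2
  linarith

theorem IsSignoriniSolution.hasWeakDivergence (hΩ : IsOpen Ω)
    (hΛ : IsEllipticTensor Ω Λ lamLow lamUp) (hu : IsSignoriniSolution Γ₁ Γ₃ Λ f a u) :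
    HasWeakDivergence (applyTensor Λ (sobGrad u)) (-f) := by
  intro φ hφ
  have h := hu.inner_eq_of_isTrace_zero hΛ (hφ.isTrace_toH1 hΩ)
  rw [← hΛ.integral_inner_applyTensor, ← integral_mul_eq_inner_L2] at h
  rw [← integral_neg]
  convert h using 1
  · refine integral_congr_ae ?_
    filter_upwards [hφ.memLp_gradient.coeFn_toLp] with x hx
    rw [hφ.sobGrad_toH1, hx]
  · refine integral_congr_ae ?_
    filter_upwards [hφ.memLp.coeFn_toLp, Lp.coeFn_neg f] with x hx hf
    rw [hφ.sobVal_toH1, hx, hf]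
    simp

theorem IsSignoriniSolution.memHDiv (hΩ : IsOpen Ω) (hΛ : IsEllipticTensor Ω Λ lamLow lamUp)
    (hu : IsSignoriniSolution Γ₁ Γ₃ Λ f a u) : MemHDiv Ω (applyTensor Λ (sobGrad u)) :=
  ⟨hΛ.memLp_applyTensor _, -f, hu.hasWeakDivergence hΩ hΛ⟩

theorem IsSignoriniSolution.weakDiv_eq (hΩ : IsOpen Ω) (hΛ : IsEllipticTensor Ω Λ lamLow lamUp)
    (hu : IsSignoriniSolution Γ₁ Γ₃ Λ f a u) : weakDiv Ω (applyTensor Λ (sobGrad u)) = -f :=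
  _root_.weakDiv_eq hΩ (hu.hasWeakDivergence hΩ hΛ)

/-- The normal trace of `Λ∇u` can be computed with any lifting of the boundary datum. -/
theorem IsSignoriniSolution.normalTrace_eq (hΩ : IsOpen Ω)
    (hΛ : IsEllipticTensor Ω Λ lamLow lamUp) (hu : IsSignoriniSolution Γ₁ Γ₃ Λ f a u)
    {g : HHalf Ω} {w : H1 Ω} (hw : IsTrace w (g : L2Bdry Ω)) :
    normalTrace (applyTensor Λ (sobGrad u)) g =
      inner ℝ (hΛ.toLinearMap (sobGrad u)) (sobGrad w) - inner ℝ f (sobVal w) := by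
  -- The lifting chosen in `normalTrace` and the given one differ by an element of zero trace, on
  -- which the functional vanishes.
  have hz : IsTrace (g.2.choose - w) (0 : L2Bdry Ω) := by
    simpa using g.2.choose_spec.sub hw
  have e := hu.inner_eq_of_isTrace_zero hΛ hz
  rw [normalTrace, hu.weakDiv_eq hΩ hΛ, hΛ.integral_inner_applyTensor, integral_mul_eq_inner_L2,
    inner_neg_left]
  rw [sobGrad_sub, sobVal_sub, inner_sub_right, inner_sub_right] at e
  linarith

end Signorini

/-! ### Finite-dimensional tools -/

/-- `T` factors through the finite-dimensional range of `G`, where every linear map is bounded. With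
`G = ∇_D` this makes the suprema `C_D` and `W_D(Λ∇ubar)` finite. -/
theorem LinearMap.exists_norm_le_of_injective {X E F : Type*} [AddCommGroup X] [Module ℝ X]
    [FiniteDimensional ℝ X] [NormedAddCommGroup E] [NormedSpace ℝ E] [NormedAddCommGroup F]
    [NormedSpace ℝ F] {G : X →ₗ[ℝ] E} (hG : Function.Injective G) (T : X →ₗ[ℝ] F) :
    ∃ C : ℝ, ∀ v, ‖T v‖ ≤ C * ‖G v‖ := by
  let e := LinearEquiv.ofInjective G hG
  refine ⟨‖(T ∘ₗ e.symm.toLinearMap).toContinuousLinearMap‖, fun v => ?_⟩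
  simpa [e] using (T ∘ₗ e.symm.toLinearMap).toContinuousLinearMap.le_opNorm (e v)

/-- A variational inequality for a symmetric positive definite bilinear form on a
finite-dimensional space has exactly one solution. -/
theorem existsUnique_variationalInequality {X E : Type*} [AddCommGroup X] [Module ℝ X]
    [FiniteDimensional ℝ X] [NormedAddCommGroup E] [NormedSpace ℝ E] (B : X →ₗ[ℝ] X →ₗ[ℝ] ℝ)
    (hsymm : ∀ v w, B v w = B w v) (hpos : ∀ v, v ≠ 0 → 0 < B v v) (l : X →ₗ[ℝ] ℝ)
    (T : X →ₗ[ℝ] E) {C : Set E} (hC : IsClosed C) (hconv : Convex ℝ C)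
    (hne : (T ⁻¹' C).Nonempty) :
    ∃! u : X, u ∈ T ⁻¹' C ∧ ∀ v ∈ T ⁻¹' C, B u (u - v) ≤ l (u - v) := by
  have hdef : ∀ v, B v v ≤ 0 → v = 0 := fun v hv => by
    by_contra h
    exact (hpos v h).not_ge hv
  refine existsUnique_of_exists_of_unique ?_ ?_
  -- Existence: make `B` the inner product, represent `l` by `z`, and project `z` onto the convex
  -- set. The obtuse-angle characterisation of the projection is the variational inequality.
  · let core : InnerProductSpace.Core ℝ X :=
      { inner := fun v w => B v w
        conj_inner_symm := fun v w => by simp [hsymm v w]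
        re_inner_nonneg := fun v => by
          rcases eq_or_ne v 0 with rfl | h
          · simp
          · simpa using (hpos v h).le
        add_left := fun u v w => by simp
        smul_left := fun u v r => by simp
        definite := fun v hv => hdef v hv.le }
    let : NormedAddCommGroup X := core.toNormedAddCommGroup
    let : InnerProductSpace ℝ X := InnerProductSpace.ofCore core.toCore
    have hK : IsClosed (T ⁻¹' C) := hC.preimage T.continuous_of_finiteDimensional
    have hKc : Convex ℝ (T ⁻¹' C) := hconv.linear_preimage T
    let z : X := (InnerProductSpace.toDual ℝ X).symm l.toContinuousLinearMap
    have hz : ∀ v, B z v = l v := fun v =>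
      InnerProductSpace.toDual_symm_apply (𝕜 := ℝ) (x := v) (y := l.toContinuousLinearMap)
    obtain ⟨u, hu, hmin⟩ := exists_norm_eq_iInf_of_complete_convex hne hK.isComplete hKc z
    refine ⟨u, hu, fun v hv => ?_⟩
    have h : B (z - u) (v - u) ≤ 0 := (norm_eq_iInf_iff_real_inner_le_zero hKc hu).1 hmin v hv
    simp only [map_sub, LinearMap.sub_apply, hz] at h ⊢
    linarith
  -- Uniqueness: testing each solution with the other and adding gives `B (u - w) (u - w) ≤ 0`.
  · rintro u w ⟨hu, hu'⟩ ⟨hw, hw'⟩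
    refine sub_eq_zero.1 (hdef _ ?_)
    have h1 := hu' w hw
    have h2 := hw' u hu
    simp only [map_sub, LinearMap.sub_apply] at h1 h2 ⊢
    linarith

/-! ### The barrier constraint and the `H^{1/2}` norm -/

section LeOn

variable {d : ℕ} {Ω Γ : Set (Eucl d)}

/-- An `L²`-convergent sequence has an a.e. convergent subsequence, and pointwise inequalities pass
to the limit. -/
theorem isClosed_setOf_leOn (b : L2Bdry Ω) : IsClosed {g : L2Bdry Ω | LeOn g b Γ} := by
  refine isClosed_of_closure_subset fun g hg => ?_
  obtain ⟨s, hs, hlim⟩ := mem_closure_iff_seq_limit.1 hg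
  obtain ⟨ns, -, hns⟩ := (tendstoInMeasure_of_tendsto_Lp hlim).exists_seq_tendsto_ae
  have h : ∀ᵐ x ∂(surfaceMeasure Ω).restrict Γ, ∀ n, s n x ≤ b x := ae_all_iff.2 hs
  have hns' := ae_restrict_of_ae (s := Γ) hns
  change ∀ᵐ x ∂(surfaceMeasure Ω).restrict Γ, g x ≤ b x
  filter_upwards [h, hns'] with x h1 h2
  exact le_of_tendsto' h2 fun n => h1 _

theorem convex_setOf_leOn (b : L2Bdry Ω) : Convex ℝ {g : L2Bdry Ω | LeOn g b Γ} := by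
  intro g hg h hh s t hs ht hst
  have e := ae_restrict_of_ae (s := Γ) (Lp.coeFn_add (s • g) (t • h))
  have e1 := ae_restrict_of_ae (s := Γ) (Lp.coeFn_smul s g)
  have e2 := ae_restrict_of_ae (s := Γ) (Lp.coeFn_smul t h)
  change ∀ᵐ x ∂(surfaceMeasure Ω).restrict Γ, (s • g + t • h : L2Bdry Ω) x ≤ b x
  filter_upwards [hg, hh, e, e1, e2] with x h1 h2 h3 h4 h5
  rw [h3, Pi.add_apply, h4, h5, Pi.smul_apply, Pi.smul_apply, smul_eq_mul, smul_eq_mul]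
  calc s * g x + t * h x ≤ s * b x + t * b x := by gcongr
    _ = b x := by rw [← add_mul, hst, one_mul]

theorem hHalfNorm_nonneg (g : HHalf Ω) : 0 ≤ hHalfNorm g :=
  Real.iInf_nonneg fun _ => norm_nonneg _

theorem hHalfNorm_le {g : HHalf Ω} {w : H1 Ω} (hw : IsTrace w (g : L2Bdry Ω)) :
    hHalfNorm g ≤ ‖w‖ :=
  ciInf_le (f := fun w : {w : H1 Ω // IsTrace w (g : L2Bdry Ω)} => ‖w.1‖)
    ⟨0, Set.forall_mem_range.2 fun _ => norm_nonneg _⟩ ⟨w, hw⟩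

end LeOn

/-! ### Well-posedness of the scheme; finiteness of `C_D` and `W_D` -/

namespace GradientDiscretisation

variable {d : ℕ} {Ω Γ₁ Γ₃ : Set (Eucl d)} {X : Type*} [AddCommGroup X] [Module ℝ X]
  (D : GradientDiscretisation Ω Γ₁ X)
  {Λ : Eucl d → Matrix (Fin d) (Fin d) ℝ} {lamLow lamUp : ℝ}
  {f : L2Dom Ω} {a b : L2Bdry Ω} {ubar : H1 Ω}

theorem recGrad_injective : Function.Injective D.recGrad :=
  (injective_iff_map_eq_zero _).2 fun v hv => D.eq_zero_of_norm_recGrad v (by rw [hv, norm_zero])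

theorem norm_recGrad_pos {v : X} (hv : v ≠ 0) : 0 < ‖D.recGrad v‖ :=
  lt_of_le_of_ne (norm_nonneg _) fun h => hv (D.eq_zero_of_norm_recGrad v h.symm)

/-- The reconstructed trace, as a linear map with values in `L²(∂Ω)`. -/
def trL2 : X →ₗ[ℝ] L2Bdry Ω :=
  (HHalf Ω).subtype ∘ₗ (HHalfZero Ω Γ₁).subtype ∘ₗ D.recTrace

theorem trL2_apply (v : X) : D.trL2 v = (D.tr v : L2Bdry Ω) := rfl

theorem tr_sub (v w : X) : D.tr (v - w) = D.tr v - D.tr w := by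
  simp [tr]

/-- Lift the traces of a basis and extend linearly. `hHalfNorm` is an infimum and `normalTrace` uses
a chosen lifting, so neither is visibly linear in `v`; a linear lifting lets both be controlled by
linear maps on `X`. -/
theorem exists_linear_lifting [FiniteDimensional ℝ X] :
    ∃ L : X →ₗ[ℝ] H1 Ω, ∀ v, IsTrace (L v) (D.tr v : L2Bdry Ω) := by
  let b := Module.finBasis ℝ X
  let L : X →ₗ[ℝ] H1 Ω := b.constr ℝ fun i => (D.tr (b i)).2.choose
  refine ⟨L, fun v => ?_⟩
  simp only [← trL2_apply]
  refine Submodule.span_induction (p := fun v _ => IsTrace (L v) (D.trL2 v)) ?_ ?_ ?_ ?_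
    (b.mem_span v)
  · rintro _ ⟨i, rfl⟩
    rw [b.constr_basis]
    exact (D.tr (b i)).2.choose_spec
  · simpa using isTrace_zero
  · intro v w _ _ hv hw
    simpa using hv.add hw
  · intro c v _ hv
    simpa using hv.smul c

/-- The bilinear form `∫_Ω Λ ∇_D v · ∇_D w`. -/
def bilinForm (hΛ : IsEllipticTensor Ω Λ lamLow lamUp) : X →ₗ[ℝ] X →ₗ[ℝ] ℝ :=
  (innerₗ (L2Vec Ω)).compl₁₂ (hΛ.toLinearMap ∘ₗ D.recGrad) D.recGrad

theorem bilinForm_apply (hΛ : IsEllipticTensor Ω Λ lamLow lamUp) (v w : X) :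
    D.bilinForm hΛ v w = inner ℝ (hΛ.toLinearMap (D.recGrad v)) (D.recGrad w) := rfl

theorem isSchemeSolution_iff (hΛ : IsEllipticTensor Ω Λ lamLow lamUp) {u : X} :
    D.IsSchemeSolution Γ₃ Λ f b u ↔ u ∈ D.barrierSet Γ₃ b ∧ ∀ v ∈ D.barrierSet Γ₃ b,
      inner ℝ (hΛ.toLinearMap (D.recGrad u)) (D.recGrad (u - v)) ≤
        inner ℝ f (D.recFun (u - v)) := by
  simp only [IsSchemeSolution, hΛ.integral_inner_applyTensor, integral_mul_eq_inner_L2]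

/-- The barrier set is the preimage under `trL2` of a closed convex subset of `L²(∂Ω)`. -/
theorem existsUnique_isSchemeSolution [FiniteDimensional ℝ X]
    (hΛ : IsEllipticTensor Ω Λ lamLow lamUp) (hne : (D.barrierSet Γ₃ b).Nonempty) :
    ∃! u : X, D.IsSchemeSolution Γ₃ Λ f b u := by
  simp only [D.isSchemeSolution_iff hΛ]
  refine existsUnique_variationalInequality (D.bilinForm hΛ) (fun v w => ?_) (fun v hv => ?_)
    (innerₗ (L2Dom Ω) f ∘ₗ D.recFun) D.trL2 (isClosed_setOf_leOn b) (convex_setOf_leOn b) hne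
  · rw [bilinForm_apply, bilinForm_apply, hΛ.isSymmetric_toLinearMap, real_inner_comm]
  · refine lt_of_lt_of_le ?_ (hΛ.le_inner_toLinearMap _)
    have := D.norm_recGrad_pos hv
    have := hΛ.low_pos
    positivity

/-- A real supremum over an unbounded family is `0` by convention, so boundedness must be known
before a ratio can be compared with `C_D`. -/
theorem bddAbove_coercivity [FiniteDimensional ℝ X] :
    BddAbove (Set.range fun v : {v : X // v ≠ 0} =>
      ‖D.recFun v‖ / ‖D.recGrad v‖ + hHalfNorm (D.tr v) / ‖D.recGrad v‖) := by
  obtain ⟨L, hL⟩ := D.exists_linear_lifting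
  obtain ⟨C, hC⟩ := LinearMap.exists_norm_le_of_injective D.recGrad_injective D.recFun
  obtain ⟨C', hC'⟩ := LinearMap.exists_norm_le_of_injective D.recGrad_injective L
  refine ⟨C + C', Set.forall_mem_range.2 fun v => ?_⟩
  have hv := D.norm_recGrad_pos v.2
  exact add_le_add ((div_le_iff₀ hv).2 (hC v))
    ((div_le_iff₀ hv).2 ((hHalfNorm_le (hL v)).trans (hC' v)))

theorem coercivity_nonneg : 0 ≤ D.coercivity :=
  Real.iSup_nonneg fun v =>
    add_nonneg (by positivity) (div_nonneg (hHalfNorm_nonneg _) (norm_nonneg _))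

theorem norm_recFun_le [FiniteDimensional ℝ X] (v : X) :
    ‖D.recFun v‖ ≤ D.coercivity * ‖D.recGrad v‖ := by
  rcases eq_or_ne v 0 with rfl | hv
  · simp
  rw [← div_le_iff₀ (D.norm_recGrad_pos hv)]
  refine le_trans ?_ (le_ciSup D.bddAbove_coercivity ⟨v, hv⟩)
  exact le_add_of_nonneg_right (div_nonneg (hHalfNorm_nonneg _) (norm_nonneg _))

theorem limitConformity_nonneg (ψ : Eucl d → Eucl d) : 0 ≤ D.limitConformity ψ :=
  Real.iSup_nonneg fun v => by positivity

/-- The functional whose dual norm is the limit-conformity indicator of `Λ∇ubar`, written with any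
lifting of the reconstructed trace. -/
theorem conformityError_eq (hΩ : IsOpen Ω) (hΛ : IsEllipticTensor Ω Λ lamLow lamUp)
    (hu : IsSignoriniSolution Γ₁ Γ₃ Λ f a ubar) {v : X} {w : H1 Ω}
    (hw : IsTrace w (D.tr v : L2Bdry Ω)) :
    (∫ x in Ω, (inner ℝ (D.recGrad v x) (applyTensor Λ (sobGrad ubar) x) +
        D.recFun v x * weakDiv Ω (applyTensor Λ (sobGrad ubar)) x)) -
      normalTrace (applyTensor Λ (sobGrad ubar)) (D.tr v) =
    inner ℝ (hΛ.toLinearMap (sobGrad ubar)) (D.recGrad v - sobGrad w) -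
      inner ℝ f (D.recFun v - sobVal w) := by
  have e : ∀ x, inner ℝ (D.recGrad v x) (applyTensor Λ (sobGrad ubar) x) =
      inner ℝ (applyTensor Λ (sobGrad ubar) x) (D.recGrad v x) := fun x => real_inner_comm _ _
  have i1 : Integrable (fun x => inner ℝ (applyTensor Λ (sobGrad ubar) x) (D.recGrad v x))
      (volume.restrict Ω) := by
    refine (L2.integrable_inner (𝕜 := ℝ) (hΛ.toLinearMap (sobGrad ubar)) (D.recGrad v)).congr ?_
    filter_upwards [hΛ.coeFn_toLinearMap (sobGrad ubar)] with x hx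
    rw [hx]
  have i2 : Integrable (fun x => D.recFun v x * (-f : L2Dom Ω) x) (volume.restrict Ω) :=
    (Lp.memLp _).integrable_mul (Lp.memLp _)
  simp only [e]
  rw [hu.weakDiv_eq hΩ hΛ, integral_add i1 i2,
    hΛ.integral_inner_applyTensor, integral_mul_eq_inner_L2, hu.normalTrace_eq hΩ hΛ hw,
    inner_neg_right, inner_sub_right, inner_sub_right,
    real_inner_comm (D.recFun v) f]
  ring

/-- Written with a linear lifting, the conformity error is a linear form `T` in `v`, hence bounded
by a multiple of `‖∇_D v‖`. -/
theorem bddAbove_limitConformity [FiniteDimensional ℝ X] (hΩ : IsOpen Ω)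
    (hΛ : IsEllipticTensor Ω Λ lamLow lamUp) (hu : IsSignoriniSolution Γ₁ Γ₃ Λ f a ubar) :
    BddAbove (Set.range fun v : {v : X // v ≠ 0} => 1 / ‖D.recGrad v‖ *
      |(∫ x in Ω, (inner ℝ (D.recGrad v x) (applyTensor Λ (sobGrad ubar) x) +
          D.recFun v x * weakDiv Ω (applyTensor Λ (sobGrad ubar)) x)) -
        normalTrace (applyTensor Λ (sobGrad ubar)) (D.tr v)|) := by
  obtain ⟨L, hL⟩ := D.exists_linear_lifting
  let Lv : X →ₗ[ℝ] L2Dom Ω :=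
    { toFun := fun v => sobVal (L v)
      map_add' := fun v w => by rw [map_add, sobVal_add]
      map_smul' := fun c v => by rw [map_smul, sobVal_smul, RingHom.id_apply] }
  let Lg : X →ₗ[ℝ] L2Vec Ω :=
    { toFun := fun v => sobGrad (L v)
      map_add' := fun v w => by rw [map_add, sobGrad_add]
      map_smul' := fun c v => by rw [map_smul, sobGrad_smul, RingHom.id_apply] }
  let T : X →ₗ[ℝ] ℝ := innerₗ (L2Vec Ω) (hΛ.toLinearMap (sobGrad ubar)) ∘ₗ (D.recGrad - Lg) -
    innerₗ (L2Dom Ω) f ∘ₗ (D.recFun - Lv)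
  obtain ⟨C, hC⟩ := LinearMap.exists_norm_le_of_injective D.recGrad_injective T
  refine ⟨C, Set.forall_mem_range.2 fun v => ?_⟩
  rw [D.conformityError_eq hΩ hΛ hu (hL v), one_div_mul_eq_div,
    div_le_iff₀ (D.norm_recGrad_pos v.2)]
  exact hC v

theorem conformityError_le [FiniteDimensional ℝ X] (hΩ : IsOpen Ω)
    (hΛ : IsEllipticTensor Ω Λ lamLow lamUp) (hu : IsSignoriniSolution Γ₁ Γ₃ Λ f a ubar)
    {v : X} {w : H1 Ω} (hw : IsTrace w (D.tr v : L2Bdry Ω)) :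
    inner ℝ (hΛ.toLinearMap (sobGrad ubar)) (D.recGrad v - sobGrad w) -
        inner ℝ f (D.recFun v - sobVal w) ≤
      D.limitConformity (applyTensor Λ (sobGrad ubar)) * ‖D.recGrad v‖ := by
  rw [← D.conformityError_eq hΩ hΛ hu hw]
  refine (le_abs_self _).trans ?_
  rcases eq_or_ne v 0 with rfl | hv
  -- The supremum excludes `v = 0`. The given `w` need not vanish there, but the lifting-free form
  -- can be re-expressed with the lifting `0`.
  · rw [D.conformityError_eq hΩ hΛ hu (v := 0) (w := 0) (by simpa [tr] using isTrace_zero)]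
    simp [sobVal_zero, sobGrad_zero]
  · rw [← div_le_iff₀ (D.norm_recGrad_pos hv), ← one_div_mul_eq_div]
    exact le_ciSup (D.bddAbove_limitConformity hΩ hΛ hu) ⟨v, hv⟩

/-- The consequence of the Signorini inequality for the discrete solution. -/
theorem normalTrace_tr_sub_le (hΩ : IsOpen Ω) (hΛ : IsEllipticTensor Ω Λ lamLow lamUp)
    (hu : IsSignoriniSolution Γ₁ Γ₃ Λ f a ubar)
    {γubar : HHalf Ω} (hγ : IsTrace ubar (γubar : L2Bdry Ω)) {δ : HHalfZero Ω Γ₁}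
    (hδ : ((δ : HHalf Ω) : L2Bdry Ω) = a - b) {u : X} (hub : u ∈ D.barrierSet Γ₃ b) (v : X) :
    normalTrace (applyTensor Λ (sobGrad ubar)) (D.tr (v - u)) ≤
      normalTrace (applyTensor Λ (sobGrad ubar)) (D.tr v - γubar) +
        normalTrace (applyTensor Λ (sobGrad ubar)) (δ : HHalf Ω) := by
  obtain ⟨w₁, h₁⟩ := (D.tr (v - u)).2
  obtain ⟨w₂, h₂⟩ := (D.tr v - γubar).2
  obtain ⟨w₃, h₃⟩ := (δ : HHalf Ω).2
  -- This competitor has trace `T_D u + (a - b)`: it vanishes on `Γ₁`, and on `Γ₃` it is at most `b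
  -- + (a - b) = a`. Its difference from `ubar` is `w₁ - (w₂ + w₃)`, so the Signorini inequality is
  -- exactly the claim.
  have hw : IsTrace (ubar - (w₁ - (w₂ + w₃))) ((D.tr u : L2Bdry Ω) + (δ : HHalf Ω)) := by
    convert hγ.sub (h₁.sub (h₂.add h₃)) using 1
    rw [tr_sub, Submodule.coe_sub, Submodule.coe_sub]
    abel
  have hmem : ubar - (w₁ - (w₂ + w₃)) ∈ signoriniSet Γ₁ Γ₃ a := by
    refine ⟨_, hw, ?_, ?_⟩
    · exact (D.recTrace u + δ).2
    · have e1 := ae_restrict_of_ae (s := Γ₃) (Lp.coeFn_add (D.tr u : L2Bdry Ω) (a - b))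
      have e2 := ae_restrict_of_ae (s := Γ₃) (Lp.coeFn_sub a b)
      rw [hδ]
      change ∀ᵐ x ∂(surfaceMeasure Ω).restrict Γ₃, ((D.tr u : L2Bdry Ω) + (a - b)) x ≤ a x
      filter_upwards [e1, e2, hub] with x h1 h2 h3
      rw [h1, Pi.add_apply, h2, Pi.sub_apply]
      linarith
  have h := hu.inner_le hΛ hmem
  rw [sub_sub_cancel] at h
  rw [hu.normalTrace_eq hΩ hΛ h₁, hu.normalTrace_eq hΩ hΛ h₂, hu.normalTrace_eq hΩ hΛ h₃]
  simp only [sobVal_sub, sobGrad_sub, sobVal_add, sobGrad_add, inner_sub_right,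
    inner_add_right] at h
  linarith

end GradientDiscretisation

/-! ### The error estimates -/

/-- If `x > α ≥ 0`, then `(x - α)² ≤ x (x - α) ≤ β`. -/
theorem Real.le_sqrt_add_of_sq_le {x α β : ℝ} (hα : 0 ≤ α) (h : x ^ 2 ≤ α * x + β) :
    x ≤ √β + α := by
  rcases le_or_gt x α with hxα | hxα
  · exact hxα.trans (le_add_of_nonneg_left (Real.sqrt_nonneg _))
  · rw [← sub_le_iff_le_add]
    refine Real.le_sqrt_of_sq_le ?_
    nlinarith

namespace GradientDiscretisation

variable {d : ℕ} {Ω Γ₁ Γ₃ : Set (Eucl d)} {X : Type*} [AddCommGroup X] [Module ℝ X]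
  [FiniteDimensional ℝ X] (D : GradientDiscretisation Ω Γ₁ X)
  {Λ : Eucl d → Matrix (Fin d) (Fin d) ℝ} {lamLow lamUp : ℝ}
  {f : L2Dom Ω} {a b : L2Bdry Ω} {ubar : H1 Ω}

theorem norm_recGrad_sub_le (hΩ : IsOpen Ω) (hΛ : IsEllipticTensor Ω Λ lamLow lamUp)
    (hu : IsSignoriniSolution Γ₁ Γ₃ Λ f a ubar)
    {γubar : HHalf Ω} (hγ : IsTrace ubar (γubar : L2Bdry Ω)) {δ : HHalfZero Ω Γ₁}
    (hδ : ((δ : HHalf Ω) : L2Bdry Ω) = a - b) {u : X} (huD : D.IsSchemeSolution Γ₃ Λ f b u)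
    {v : X} (hv : v ∈ D.barrierSet Γ₃ b) :
    ‖D.recGrad (u - v)‖ ≤
      √(2 / lamLow * max 0 (normalTrace (applyTensor Λ (sobGrad ubar)) (D.tr v - γubar) +
        normalTrace (applyTensor Λ (sobGrad ubar)) (δ : HHalf Ω))) +
      1 / lamLow * (D.limitConformity (applyTensor Λ (sobGrad ubar)) +
        lamUp * ‖D.recGrad v - sobGrad ubar‖) := by
  have hlow := hΛ.low_pos
  have hup := hΛ.up_pos
  set ψ := applyTensor Λ (sobGrad ubar)
  set G := normalTrace ψ (D.tr v - γubar) + normalTrace ψ (δ : HHalf Ω)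
  set W := D.limitConformity ψ
  have hW : 0 ≤ W := D.limitConformity_nonneg ψ
  rw [D.isSchemeSolution_iff hΛ] at huD
  obtain ⟨w, hw⟩ := (D.tr (v - u)).2
  have h1 := D.normalTrace_tr_sub_le hΩ hΛ hu hγ hδ huD.1 v
  rw [hu.normalTrace_eq hΩ hΛ hw] at h1
  have h2 := D.conformityError_le hΩ hΛ hu hw
  have h3 := huD.2 v hv
  have h4 := hΛ.le_inner_toLinearMap (D.recGrad (u - v))
  have h5 : inner ℝ (hΛ.toLinearMap (D.recGrad v - sobGrad ubar)) (D.recGrad (v - u)) ≤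
      lamUp * ‖D.recGrad v - sobGrad ubar‖ * ‖D.recGrad (v - u)‖ :=
    (real_inner_le_norm _ _).trans
      (mul_le_mul_of_nonneg_right (hΛ.norm_toLinearMap_le _) (norm_nonneg _))
  have hn : ‖D.recGrad (v - u)‖ = ‖D.recGrad (u - v)‖ := by
    rw [map_sub, map_sub, norm_sub_rev]
  rw [hn] at h2 h5
  set S := ‖D.recGrad v - sobGrad ubar‖
  set x := ‖D.recGrad (u - v)‖
  -- The sum of `h1` to `h5`: coercivity `h4`, the scheme `h3`, replacement of `Λ∇_D v` by `Λ∇ubar`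
  -- at cost `h5`, conformity `h2`, boundary bound `h1`. The lifting `w` enters `h1` and `h2` with
  -- opposite signs and cancels.
  have key : lamLow * x ^ 2 ≤ (W + lamUp * S) * x + G := by
    simp only [map_sub, inner_sub_left, inner_sub_right] at h1 h2 h3 h4 h5
    linarith
  have hx : x ^ 2 ≤ 1 / lamLow * (W + lamUp * S) * x + 2 / lamLow * max 0 G := by
    -- The factor `2` is slack: the argument would give `√(max 0 G / lamLow)`.
    have hG : G ≤ 2 * max 0 G := by
      have := le_max_left 0 G
      have := le_max_right 0 G
      linarith
    have e : 1 / lamLow * (W + lamUp * S) * x + 2 / lamLow * max 0 G =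
        ((W + lamUp * S) * x + 2 * max 0 G) / lamLow := by
      field_simp
    rw [e, le_div_iff₀ hlow]
    linarith
  exact Real.le_sqrt_add_of_sq_le (by positivity) hx

end GradientDiscretisation

theorem theorem6p1 {d : ℕ} (hd : 1 ≤ d)
    (Ω : Set (Eucl d)) (hΩ_open : IsOpen Ω) (hΩ_bdd : Bornology.IsBounded Ω)
    (hΩ_conn : IsConnected Ω) (hΩ_lip : HasLipschitzBoundary Ω)
    (Λ : Eucl d → Matrix (Fin d) (Fin d) ℝ)
    (hΛ_meas : ∀ i j, AEMeasurable (fun x => Λ x i j) (volume.restrict Ω))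
    (lamLow lamUp : ℝ) (hlamLow : 0 < lamLow) (hlamUp : 0 < lamUp)
    (hΛ : ∀ᵐ x ∂volume.restrict Ω, (Λ x).IsSymm ∧
      ∀ μ : ℝ, Module.End.HasEigenvalue (Matrix.toLin' (Λ x)) μ → μ ∈ Set.Icc lamLow lamUp)
    (Γ₁ Γ₂ Γ₃ : Set (Eucl d))
    (hΓ₁_meas : NullMeasurableSet Γ₁ (surfaceMeasure Ω))
    (hΓ₂_meas : NullMeasurableSet Γ₂ (surfaceMeasure Ω))
    (hΓ₃_meas : NullMeasurableSet Γ₃ (surfaceMeasure Ω))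
    (hΓ₁₂ : Disjoint Γ₁ Γ₂) (hΓ₁₃ : Disjoint Γ₁ Γ₃) (hΓ₂₃ : Disjoint Γ₂ Γ₃)
    (hΓ : Γ₁ ∪ Γ₂ ∪ Γ₃ = frontier Ω) (hΓ₁_pos : 0 < surfaceMeasure Ω Γ₁)
    (f : L2Dom Ω) (a : L2Bdry Ω)
    -- the solution of the Signorini problem and its trace
    (ubar : H1 Ω) (hubar : IsSignoriniSolution Γ₁ Γ₃ Λ f a ubar)
    (γubar : HHalf Ω) (hγubar : IsTrace ubar (γubar : L2Bdry Ω))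
    -- the gradient discretisation and the approximate barrier
    {X : Type*} [AddCommGroup X] [Module ℝ X] [FiniteDimensional ℝ X]
    (D : GradientDiscretisation Ω Γ₁ X) (aD : L2Bdry Ω)
    (hne : (D.barrierSet Γ₃ aD).Nonempty) :
    (∃! u : X, D.IsSchemeSolution Γ₃ Λ f aD u) ∧
    MemHDiv Ω (applyTensor Λ (sobGrad ubar)) ∧
    ∀ δ : HHalfZero Ω Γ₁, ((δ : HHalf Ω) : L2Bdry Ω) = a - aD →
      ∀ u : X, D.IsSchemeSolution Γ₃ Λ f aD u →
      ∀ v ∈ D.barrierSet Γ₃ aD,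
        let ψ : Eucl d → Eucl d := applyTensor Λ (sobGrad ubar)
        let G : ℝ := normalTrace ψ (D.tr v - γubar) + normalTrace ψ (δ : HHalf Ω)
        ‖D.recGrad u - sobGrad ubar‖ ≤
            √(2 / lamLow * max 0 G) +
              1 / lamLow * (D.limitConformity ψ + (lamUp + lamLow) * D.consistency ubar v) ∧
          ‖D.recFun u - sobVal ubar‖ ≤
            D.coercivity * √(2 / lamLow * max 0 G) +
              1 / lamLow * (D.coercivity * D.limitConformity ψ +
                (D.coercivity * lamUp + lamLow) * D.consistency ubar v) := by
  have hE : IsEllipticTensor Ω Λ lamLow lamUp := ⟨hΛ_meas, hlamLow, hlamUp, hΛ⟩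
  refine ⟨D.existsUnique_isSchemeSolution hE hne, hubar.memHDiv hΩ_open hE, ?_⟩
  intro δ hδ u hu v hv ψ G
  have h := D.norm_recGrad_sub_le hΩ_open hE hubar hγubar hδ hu hv
  change ‖D.recGrad (u - v)‖ ≤ √(2 / lamLow * max 0 G) +
    1 / lamLow * (D.limitConformity ψ + lamUp * ‖D.recGrad v - sobGrad ubar‖) at h
  have hC := D.coercivity_nonneg
  have hF : 0 ≤ ‖D.recFun v - sobVal ubar‖ := norm_nonneg _
  have hS : ‖D.recGrad v - sobGrad ubar‖ ≤ D.consistency ubar v := le_add_of_nonneg_left hF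
  have hS' : ‖D.recFun v - sobVal ubar‖ ≤ D.consistency ubar v :=
    le_add_of_nonneg_right (norm_nonneg _)
  have h' : ‖D.recGrad (u - v)‖ ≤ √(2 / lamLow * max 0 G) +
      1 / lamLow * (D.limitConformity ψ + lamUp * D.consistency ubar v) := by
    refine h.trans ?_
    gcongr
  constructor
  -- The interpolation error `∇_D v - ∇ubar` adds one more `S_D`, which is the `lamLow` term after
  -- factoring out `1 / lamLow`.
  · calc ‖D.recGrad u - sobGrad ubar‖
        = ‖D.recGrad (u - v) + (D.recGrad v - sobGrad ubar)‖ := by rw [map_sub]; congr 1; abel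
      _ ≤ _ := norm_add_le _ _
      _ ≤ _ := add_le_add h' hS
      _ = _ := by field_simp; ring
  -- Here `C_D` converts the gradient bound on `u - v` into one on `Π_D(u - v)`; the interpolation
  -- error of `v` carries no factor `C_D`.
  · calc ‖D.recFun u - sobVal ubar‖
        = ‖D.recFun (u - v) + (D.recFun v - sobVal ubar)‖ := by rw [map_sub]; congr 1; abel
      _ ≤ _ := norm_add_le _ _
      _ ≤ _ := add_le_add ((D.norm_recFun_le _).trans (mul_le_mul_of_nonneg_left h' hC)) hS'
      _ = _ := by field_simp; ring

end
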